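/- Let $\Lambda\subset\mathbb{R}^d$ be a measurable container of finite volume $|\Lambda|>0$, put $\varepsilon=1/(2|\Lambda|)$, and for $t>0$ consider the gas of point particles in $\Lambda$ with the uniformly repulsive pair potential $\phi(x_i-x_j)=t/|\Lambda|$. Let $$\Xi_\Lambda(t,z)=\sum_{n\ge 0}\frac{z^n}{n!}\int_{\Lambda^n}\exp\Big(-\sum_{1\le i<j\le n}\phi(x_i-x_j)\Big)\,dx_1\cdots dx_n$$ be its grand canonical partition function, let $$\wp(t,z)=\frac{1}{|\Lambda|}\log\Xi_\Lambda(t,z)=\sum_{n\ge 1}b_n(t)z^n$$ be the Mayer series of the pressure (a formal power series in the activity $z$), let $\mathcal{R}_\wp(t)$ be its radius of convergence, and let $$\lambda(t)=\int_\Lambda|e^{-\phi}-1|\,dx=|\Lambda|\,(1-e^{-t/|\Lambda|})=\frac{1-e^{-2\varepsilon t}}{2\varepsilon}.$$ Then: 1. for fixed $\Lambda$, the normalized radius of convergence $\lambda(t)\mathcal{R}_\wp(t)$ is a strictly increasing function of $t\in(0,\infty)$; 2. $\dfrac1e\le\lambda(t)\mathcal{R}_\wp(t)\le 1$ for every $0<t<\infty$;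 3. the two bounds are attained at the two extreme points: $\lim_{t\searrow0}\lambda(t)\mathcal{R}_\wp(t)=\dfrac1e$ and $\lim_{t\to\infty}\lambda(t)\mathcal{R}_\wp(t)=1$; 4. the Mayer series of the density, $\rho(t,z)=z\,\partial_z\wp(t,z)=\sum_{n\ge1}n\,b_n(t)z^n$, has the same radius of convergence $\mathcal{R}_\wp(t)$ for every $t>0$, so that items 1–3 hold for the density as well; 5. for every fixed $0<t<\infty$, $\lambda(t)\mathcal{R}_\wp(t)\to\dfrac1e$ as $\varepsilon\to0$, that is, as $|\Lambda|\to\infty$. -/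

import Mathlib

open MeasureTheory Set Filter Topology
open scoped ENNReal

noncomputable section

namespace UniformGas

/-- A container: a measurable region of `ℝ^d` of positive finite volume. -/
structure Container (d : ℕ) where
  carrier : Set (EuclideanSpace ℝ (Fin d))
  measurableSet : MeasurableSet carrier
  volume_ne_zero : volume carrier ≠ 0
  volume_ne_top : volume carrier ≠ ∞

variable {d : ℕ}

/-- The volume `|Λ|` of the container. -/
def Container.vol (Λ : Container d) : ℝ := volume.real Λ.carrier

/-- The parameter `ε = 1 / (2 |Λ|)`. -/
def Container.eps (Λ : Container d) : ℝ := 1 / (2 * Λ.vol)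

theorem Container.vol_pos (Λ : Container d) : 0 < Λ.vol :=
  ENNReal.toReal_pos Λ.volume_ne_zero Λ.volume_ne_top

/-- The uniformly repulsive pair potential `φ_Λ(t; x) = t / |Λ|`, as a function of the difference
`x` of two positions. -/
def uniformPotential (Λ : Container d) (t : ℝ) : EuclideanSpace ℝ (Fin d) → ℝ :=
  fun _ => t / Λ.vol

/-- The energy `U(x) = ∑_{i < j} φ(x_i - x_j)` of a configuration of `n` particles. -/
def energy (φ : EuclideanSpace ℝ (Fin d) → ℝ) {n : ℕ}
    (x : Fin n → EuclideanSpace ℝ (Fin d)) : ℝ :=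
  ∑ p : Fin n × Fin n with p.1 < p.2, φ (x p.1 - x p.2)

/-- The canonical partition function `Q_{Λ,n} = (1/n!) ∫_{Λ^n} e^{-U(x)} dx`. -/
def canonicalPartition (Λ : Container d) (φ : EuclideanSpace ℝ (Fin d) → ℝ) (n : ℕ) : ℝ :=
  1 / (n.factorial : ℝ) *
    ∫ x in {x : Fin n → EuclideanSpace ℝ (Fin d) | ∀ i, x i ∈ Λ.carrier}, Real.exp (-energy φ x)

/-- The grand canonical partition function `Ξ_Λ(z) = ∑_n Q_{Λ,n} z^n`, as a power series in the
activity `z`. -/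
def grandPartition (Λ : Container d) (φ : EuclideanSpace ℝ (Fin d) → ℝ) : PowerSeries ℝ :=
  PowerSeries.mk (canonicalPartition Λ φ)

/-- `Ξ_Λ` has constant term `1`, so its formal logarithm is meaningful. -/
theorem constantCoeff_grandPartition (Λ : Container d) (φ : EuclideanSpace ℝ (Fin d) → ℝ) :
    PowerSeries.constantCoeff (grandPartition Λ φ) = 1 := by
  have h : (volume : Measure (Fin 0 → EuclideanSpace ℝ (Fin d))).real Set.univ = 1 := by
    rw [volume_pi, Measure.real, Measure.pi_of_empty _ 0]
    simp
  simp [grandPartition, canonicalPartition, energy,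
    ← PowerSeries.coeff_zero_eq_constantCoeff_apply, h]

/-- The Mayer series of the pressure, `℘_Λ(z) = |Λ|⁻¹ log Ξ_Λ(z) = ∑_{n ≥ 1} b_n z^n`, as a power
series in the activity `z`. -/
def pressureSeries (Λ : Container d) (φ : EuclideanSpace ℝ (Fin d) → ℝ) : PowerSeries ℝ :=
  PowerSeries.C (1 / Λ.vol) * PowerSeries.logOf (grandPartition Λ φ)

/-- The Mayer series of the density, `ρ_Λ(z) = z ℘_Λ'(z) = ∑_{n ≥ 1} n b_n z^n`. -/
def densitySeries (Λ : Container d) (φ : EuclideanSpace ℝ (Fin d) → ℝ) : PowerSeries ℝ :=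
  PowerSeries.X * PowerSeries.derivative ℝ (pressureSeries Λ φ)

/-- The radius of convergence, in the complex plane, of a power series with real coefficients. -/
def convergenceRadius (f : PowerSeries ℝ) : ℝ≥0∞ :=
  (FormalMultilinearSeries.ofScalars ℂ (fun n => ((PowerSeries.coeff n f : ℝ) : ℂ))).radius

/-- The `L¹` norm over `Λ` of the Mayer function `e^{-φ} - 1`. -/
def mayerNorm (Λ : Container d) (φ : EuclideanSpace ℝ (Fin d) → ℝ) : ℝ :=
  ∫ y in Λ.carrier, |Real.exp (-φ y) - 1|

/-- `λ(t)`: the `L¹` norm of the Mayer function of the uniformly repulsive potential. -/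
def lam (Λ : Container d) (t : ℝ) : ℝ := mayerNorm Λ (uniformPotential Λ t)

/-- `λ(t) = |Λ| (1 - e^{-t/|Λ|})`. -/
theorem lam_eq (Λ : Container d) {t : ℝ} (ht : 0 ≤ t) :
    lam Λ t = Λ.vol * (1 - Real.exp (-(t / Λ.vol))) := by
  have h : Real.exp (-(t / Λ.vol)) - 1 ≤ 0 := by
    have : 0 ≤ t / Λ.vol := div_nonneg ht Λ.vol_pos.le
    simpa using this
  unfold lam mayerNorm uniformPotential
  rw [abs_of_nonpos h, setIntegral_const, smul_eq_mul, neg_sub]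
  rfl

/-- The radius of convergence of the Mayer series of the pressure at parameter `t`. -/
def mayerRadius (Λ : Container d) (t : ℝ) : ℝ≥0∞ :=
  convergenceRadius (pressureSeries Λ (uniformPotential Λ t))

/-- The normalized radius of convergence `λ(t) R_℘(t)`. -/
def normalizedRadius (Λ : Container d) (t : ℝ) : ℝ≥0∞ :=
  ENNReal.ofReal (lam Λ t) * mayerRadius Λ t

end UniformGas

end

/-! The energy of `n` particles is constant, so with `q = exp (-t/|Λ|)` the partition function is
`ψ(-|Λ| z)`, where `ψ(x) = ∑ (-1)^n q^(n(n-1)/2) x^n / n!` is entire and solves the pantograph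
equation `ψ'(x) = -ψ(q x)`. Hence `℘'(z) = G(-|Λ| z)` with `G(x) = ψ(q x) / ψ(x)`. Since `G' = G (G
- q G(q ·))`, the coefficients of `G` are nonnegative, so its radius of convergence is the first
positive zero `Z(q)` of `ψ` (`summable_ratio_iff`). Because `λ = |Λ| (1 - q)`, everything reduces to
`N(q) = (1 - q) Z(q)`.

In the variable `u = (1 - q) x` the coefficients of `G` are at least `1` and increase with `q`; thus
`N ≤ 1` and `N` is antitone. Strictness comes from the pole at `u = N(q)`, whose strength `1 - q`
decreases in `q` and so contradicts the coefficient comparison if two values of `N` agree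
(`normZero_strictAnti`).

The bound `N > 1/e` follows from `G(x) = exp (∫ G over [q x, x])`, iterated on partial sums. As `q →
1`, the matching upper bound is the oscillation criterion for delay equations
(`eventually_normZero_le`): a positive solution cannot persist once the effective delay exceeds
`1/e`. As `q → 0`, `Z ≥ 1` gives `1 - q ≤ N ≤ 1`. -/

noncomputable section

namespace UniformGas

/-! ### Formal power series: the deformed exponential and its ratio series -/

/-- The deformed exponential series `∑ (-1)^n q^{n(n-1)/2} x^n / n!`. -/
def altExp (q : ℝ) : PowerSeries ℝ :=
  PowerSeries.mk fun n => (-1) ^ n * q ^ n.choose 2 / (n.factorial : ℝ)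

theorem constantCoeff_altExp (q : ℝ) : PowerSeries.constantCoeff (altExp q) = 1 := by
  simp [altExp, ← PowerSeries.coeff_zero_eq_constantCoeff_apply]

theorem altExp_ne_zero (q : ℝ) : altExp q ≠ 0 := by
  intro h
  have := constantCoeff_altExp q
  simp [h] at this

theorem derivative_altExp (q : ℝ) :
    PowerSeries.derivative ℝ (altExp q) = -PowerSeries.rescale q (altExp q) := by
  ext n
  have h : (n.factorial : ℝ) ≠ 0 := by positivity
  have h' : (n + 1 : ℝ) ≠ 0 := by positivity
  simp only [PowerSeries.coeff_derivative, altExp, PowerSeries.coeff_mk, map_neg,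
    PowerSeries.coeff_rescale, Nat.factorial_succ, Nat.choose_succ_succ' n 1, Nat.choose_one_right,
    pow_add, Nat.cast_mul, Nat.cast_add, Nat.cast_one]
  field_simp

theorem derivative_rescale {R : Type*} [CommRing R] (a : R) (f : PowerSeries R) :
    PowerSeries.derivative R (PowerSeries.rescale a f) =
      PowerSeries.C a * PowerSeries.rescale a (PowerSeries.derivative R f) := by
  ext n
  simp only [PowerSeries.coeff_derivative, PowerSeries.coeff_rescale, PowerSeries.coeff_C_mul]
  ring

/-- The series `G` with `G(x) ψ(x) = ψ(q x)`, where `ψ` is the deformed exponential `altExp q`. -/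
def ratioSeries (q : ℝ) : PowerSeries ℝ :=
  (altExp q)⁻¹ * PowerSeries.rescale q (altExp q)

theorem altExp_mul_ratioSeries (q : ℝ) :
    altExp q * ratioSeries q = PowerSeries.rescale q (altExp q) := by
  rw [ratioSeries, ← mul_assoc, PowerSeries.mul_inv_cancel, one_mul]
  simp [constantCoeff_altExp]

/-- Differentiate `ψ G = ψ(q ·)`, replace each `ψ'` by `-ψ(q ·) = -ψ G`, and cancel `ψ`. Read on
coefficients, this gives a recursion with the nonnegative weights `1 - q^(k+1)`. -/
theorem derivative_ratioSeries (q : ℝ) :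
    PowerSeries.derivative ℝ (ratioSeries q) =
      ratioSeries q * (ratioSeries q - PowerSeries.C q * PowerSeries.rescale q (ratioSeries q)) := by
  have h := altExp_mul_ratioSeries q
  have hd := congrArg (PowerSeries.derivative ℝ) h
  rw [derivative_rescale, derivative_altExp, Derivation.leibniz, derivative_altExp, map_neg,
    smul_eq_mul, smul_eq_mul, ← h, map_mul, ← h] at hd
  apply mul_left_cancel₀ (altExp_ne_zero q)
  linear_combination hd

/-- The coefficients of `ratioSeries q`. -/
def ratioCoeff (q : ℝ) (n : ℕ) : ℝ := PowerSeries.coeff n (ratioSeries q)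

theorem ratioCoeff_zero (q : ℝ) : ratioCoeff q 0 = 1 := by
  simp [ratioCoeff, ratioSeries, constantCoeff_altExp]
  rw [← PowerSeries.coeff_zero_eq_constantCoeff_apply, PowerSeries.coeff_rescale]
  simp [constantCoeff_altExp]

theorem ratioCoeff_succ (q : ℝ) (n : ℕ) :
    (n + 1 : ℝ) * ratioCoeff q (n + 1) =
      ∑ p ∈ Finset.HasAntidiagonal.antidiagonal n,
        ratioCoeff q p.1 * (ratioCoeff q p.2 * (1 - q ^ (p.2 + 1))) := by
  have h := congrArg (PowerSeries.coeff n) (derivative_ratioSeries q)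
  rw [PowerSeries.coeff_derivative, PowerSeries.coeff_mul] at h
  rw [mul_comm]
  refine h.trans (Finset.sum_congr rfl fun p _ => ?_)
  simp only [map_sub, PowerSeries.coeff_C_mul, PowerSeries.coeff_rescale, ratioCoeff]
  ring

theorem ratioCoeff_nonneg {q : ℝ} (h0 : 0 ≤ q) (h1 : q ≤ 1) (n : ℕ) : 0 ≤ ratioCoeff q n := by
  induction n using Nat.strong_induction_on with
  | _ n ih =>
    cases n with
    | zero => simp [ratioCoeff_zero]
    | succ n =>
      have h : 0 ≤ (n + 1 : ℝ) * ratioCoeff q (n + 1) := by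
        rw [ratioCoeff_succ]
        refine Finset.sum_nonneg fun p hp => ?_
        have := Finset.HasAntidiagonal.mem_antidiagonal.1 hp
        have h3 : q ^ (p.2 + 1) ≤ 1 := pow_le_one₀ h0 h1
        exact mul_nonneg (ih _ (by omega)) (mul_nonneg (ih _ (by omega)) (by linarith))
      exact nonneg_of_mul_nonneg_right h (by positivity)

/-! ### Normalized coefficients: positivity, monotonicity in `q`, lower bound -/

/-- The coefficients of `ratioSeries q` in the normalized variable `(1 - q) x`. -/
def normCoeff (q : ℝ) (n : ℕ) : ℝ := ratioCoeff q n / (1 - q) ^ n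

theorem normCoeff_zero (q : ℝ) : normCoeff q 0 = 1 := by simp [normCoeff, ratioCoeff_zero]

theorem ratioCoeff_eq {q : ℝ} (h1 : q < 1) (n : ℕ) :
    ratioCoeff q n = normCoeff q n * (1 - q) ^ n := by
  have : (1 - q) ^ n ≠ 0 := pow_ne_zero _ (by linarith)
  rw [normCoeff]; field_simp

theorem normCoeff_nonneg {q : ℝ} (h0 : 0 ≤ q) (h1 : q ≤ 1) (n : ℕ) : 0 ≤ normCoeff q n :=
  div_nonneg (ratioCoeff_nonneg h0 h1 n) (pow_nonneg (by linarith) _)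

/-- The normalization turns the weight `1 - q^(k+1)`, decreasing in `q`, into the `q`-integer `1 + q
+ ... + q^k`, which is increasing in `q` and at least `1`. Both later comparisons of coefficients
rest on this. -/
theorem normCoeff_succ {q : ℝ} (h1 : q < 1) (n : ℕ) :
    (n + 1 : ℝ) * normCoeff q (n + 1) =
      ∑ p ∈ Finset.HasAntidiagonal.antidiagonal n,
        normCoeff q p.1 * (normCoeff q p.2 * ∑ i ∈ Finset.range (p.2 + 1), q ^ i) := by
  have h2 : (1 - q) ^ (n + 1) ≠ 0 := pow_ne_zero _ (by linarith)
  apply mul_right_cancel₀ h2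
  rw [mul_assoc, ← ratioCoeff_eq h1, ratioCoeff_succ, Finset.sum_mul]
  refine Finset.sum_congr rfl fun p hp => ?_
  rw [← Finset.HasAntidiagonal.mem_antidiagonal.1 hp, ratioCoeff_eq h1, ratioCoeff_eq h1, ← geom_sum_mul_neg q]
  ring

theorem normCoeff_mono {q r : ℝ} (h0 : 0 ≤ q) (hqr : q ≤ r) (h1 : r < 1) (n : ℕ) :
    normCoeff q n ≤ normCoeff r n := by
  induction n using Nat.strong_induction_on with
  | _ n ih =>
    cases n with
    | zero => simp [normCoeff_zero]
    | succ n =>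
      have h : (n + 1 : ℝ) * normCoeff q (n + 1) ≤ (n + 1 : ℝ) * normCoeff r (n + 1) := by
        rw [normCoeff_succ (hqr.trans_lt h1), normCoeff_succ h1]
        refine Finset.sum_le_sum fun p hp => ?_
        have := Finset.HasAntidiagonal.mem_antidiagonal.1 hp
        have hq := normCoeff_nonneg h0 (hqr.trans h1.le)
        have hr := normCoeff_nonneg (h0.trans hqr) h1.le
        have hs : ∑ i ∈ Finset.range (p.2 + 1), q ^ i ≤ ∑ i ∈ Finset.range (p.2 + 1), r ^ i :=
          Finset.sum_le_sum fun i _ => pow_le_pow_left₀ h0 hqr i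
        have hs0 : 0 ≤ ∑ i ∈ Finset.range (p.2 + 1), q ^ i :=
          Finset.sum_nonneg fun i _ => pow_nonneg h0 i
        exact mul_le_mul (ih _ (by omega))
          (mul_le_mul (ih _ (by omega)) hs hs0 (hr _)) (mul_nonneg (hq _) hs0) (hr _)
      exact le_of_mul_le_mul_left h (by positivity)

theorem one_le_normCoeff {q : ℝ} (h0 : 0 ≤ q) (h1 : q < 1) (n : ℕ) : 1 ≤ normCoeff q n := by
  induction n using Nat.strong_induction_on with
  | _ n ih =>
    cases n with
    | zero => simp [normCoeff_zero]
    | succ n =>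
      have h : (n + 1 : ℝ) * 1 ≤ (n + 1 : ℝ) * normCoeff q (n + 1) := by
        rw [normCoeff_succ h1]
        have : (n + 1 : ℝ) * 1 = ∑ p ∈ Finset.HasAntidiagonal.antidiagonal n, (1 : ℝ) := by simp
        rw [this]
        refine Finset.sum_le_sum fun p hp => ?_
        have := Finset.HasAntidiagonal.mem_antidiagonal.1 hp
        have hs : 1 ≤ ∑ i ∈ Finset.range (p.2 + 1), q ^ i := by
          rw [Finset.sum_range_succ']
          simpa using Finset.sum_nonneg fun i _ => pow_nonneg h0 (i + 1)
        exact one_le_mul_of_one_le_of_one_le (ih _ (by omega))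
          (one_le_mul_of_one_le_of_one_le (ih _ (by omega)) hs)
      exact le_of_mul_le_mul_left h (by positivity)

/-! ### Partial sums: exponential bound and convergence up to `1/e` -/

/-- Partial sums of `ratioSeries q`. -/
def partialRatio (q : ℝ) (N : ℕ) (x : ℝ) : ℝ := ∑ k ∈ Finset.range N, ratioCoeff q k * x ^ k

/-- The primitive of `partialRatio q N` vanishing at `0`. -/
def primitiveRatio (q : ℝ) (N : ℕ) (x : ℝ) : ℝ :=
  ∑ k ∈ Finset.range N, ratioCoeff q k / (k + 1) * x ^ (k + 1)

theorem hasDerivAt_primitiveRatio (q : ℝ) (N : ℕ) (x : ℝ) :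
    HasDerivAt (primitiveRatio q N) (partialRatio q N x) x := by
  unfold primitiveRatio partialRatio
  refine HasDerivAt.fun_sum fun k _ => ?_
  have h := (hasDerivAt_pow (k + 1) x).const_mul (ratioCoeff q k / (k + 1))
  convert! h using 1
  have : (k + 1 : ℝ) ≠ 0 := by positivity
  push_cast
  field_simp

theorem hasDerivAt_partialRatio (q : ℝ) (N : ℕ) (x : ℝ) :
    HasDerivAt (partialRatio q (N + 1))
      (∑ k ∈ Finset.range N, (k + 1 : ℝ) * ratioCoeff q (k + 1) * x ^ k) x := by
  have h : partialRatio q (N + 1) =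
      fun x => (∑ k ∈ Finset.range N, ratioCoeff q (k + 1) * x ^ (k + 1)) + ratioCoeff q 0 := by
    funext y
    simp [partialRatio, Finset.sum_range_succ']
  rw [h]
  refine HasDerivAt.add_const _ (HasDerivAt.fun_sum fun k _ => ?_)
  convert! (hasDerivAt_pow (k + 1) x).const_mul (ratioCoeff q (k + 1)) using 1
  push_cast
  ring

theorem partialRatio_nonneg {q x : ℝ} (h0 : 0 ≤ q) (h1 : q ≤ 1) (hx : 0 ≤ x) (N : ℕ) :
    0 ≤ partialRatio q N x :=
  Finset.sum_nonneg fun k _ => mul_nonneg (ratioCoeff_nonneg h0 h1 k) (pow_nonneg hx k)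

theorem sum_antidiagonal_le_mul {f g : ℕ → ℝ} (hf : ∀ n, 0 ≤ f n) (hg : ∀ n, 0 ≤ g n) (N : ℕ) :
    ∑ k ∈ Finset.range N, ∑ p ∈ Finset.HasAntidiagonal.antidiagonal k, f p.1 * g p.2 ≤
      (∑ k ∈ Finset.range N, f k) * ∑ k ∈ Finset.range N, g k := by
  rw [Finset.sum_mul_sum, ← Finset.sum_product', ← Finset.sum_biUnion]
  · refine Finset.sum_le_sum_of_subset_of_nonneg ?_ fun p _ _ => mul_nonneg (hf _) (hg _)
    intro p hp
    simp only [Finset.mem_biUnion, Finset.mem_range, Finset.HasAntidiagonal.mem_antidiagonal,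
      Finset.mem_product] at hp ⊢
    omega
  · intro a _ b _ hab
    rw [Function.onFun, Finset.disjoint_left]
    intro p hp hp'
    rw [Finset.HasAntidiagonal.mem_antidiagonal] at hp hp'
    omega

/-- A truncation of `G' = G (G - q G(q ·))`: the Cauchy product up to degree `N` is part of the
product of the truncations, and the omitted terms are nonnegative. -/
theorem deriv_partialRatio_le {q x : ℝ} (h0 : 0 ≤ q) (h1 : q ≤ 1) (hx : 0 ≤ x) (N : ℕ) :
    ∑ k ∈ Finset.range N, (k + 1 : ℝ) * ratioCoeff q (k + 1) * x ^ k ≤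
      partialRatio q (N + 1) x * (partialRatio q N x - q * partialRatio q N (q * x)) := by
  have hc := ratioCoeff_nonneg h0 h1
  have hq : ∀ k, 0 ≤ 1 - q ^ (k + 1) := fun k => sub_nonneg.2 (pow_le_one₀ h0 h1)
  have hg : ∀ k, 0 ≤ ratioCoeff q k * (1 - q ^ (k + 1)) * x ^ k := fun k =>
    mul_nonneg (mul_nonneg (hc k) (hq k)) (pow_nonneg hx k)
  have e1 : partialRatio q N x - q * partialRatio q N (q * x) =
      ∑ k ∈ Finset.range N, ratioCoeff q k * (1 - q ^ (k + 1)) * x ^ k := by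
    rw [partialRatio, partialRatio, Finset.mul_sum, ← Finset.sum_sub_distrib]
    refine Finset.sum_congr rfl fun k _ => ?_
    rw [mul_pow]; ring
  rw [e1]
  calc _ = ∑ k ∈ Finset.range N, ∑ p ∈ Finset.HasAntidiagonal.antidiagonal k,
        (ratioCoeff q p.1 * x ^ p.1) * (ratioCoeff q p.2 * (1 - q ^ (p.2 + 1)) * x ^ p.2) := by
        refine Finset.sum_congr rfl fun k _ => ?_
        rw [ratioCoeff_succ, Finset.sum_mul]
        refine Finset.sum_congr rfl fun p hp => ?_
        rw [← Finset.HasAntidiagonal.mem_antidiagonal.1 hp]; ring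
    _ ≤ partialRatio q N x * _ :=
        sum_antidiagonal_le_mul (fun k => mul_nonneg (hc k) (pow_nonneg hx k)) hg N
    _ ≤ _ := by
        refine mul_le_mul_of_nonneg_right ?_ (Finset.sum_nonneg fun k _ => hg k)
        rw [partialRatio, partialRatio, Finset.sum_range_succ]
        exact le_add_of_nonneg_right (mul_nonneg (hc N) (pow_nonneg hx N))

/-- The truncated form of `G(x) = exp (∫ G over [q x, x])`: by the preceding differential
inequality, the quotient of the two sides is antitone on `[0, ∞)` and equals `1` at `0`. Raising the
index by one makes inductions on `N` possible without assuming convergence. -/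
theorem partialRatio_succ_le_exp {q x : ℝ} (h0 : 0 ≤ q) (h1 : q ≤ 1) (hx : 0 ≤ x) (N : ℕ) :
    partialRatio q (N + 1) x ≤ Real.exp (primitiveRatio q N x - primitiveRatio q N (q * x)) := by
  set f : ℝ → ℝ := fun y => partialRatio q (N + 1) y *
    Real.exp (-(primitiveRatio q N y - primitiveRatio q N (q * y))) with hf
  have hd : ∀ y, HasDerivAt f _ y := fun y =>
    (hasDerivAt_partialRatio q N y).mul
      (((hasDerivAt_primitiveRatio q N y).sub
        ((hasDerivAt_primitiveRatio q N (q * y)).comp y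
          ((hasDerivAt_id y).const_mul q))).neg.exp)
  have hanti : AntitoneOn f (Ici 0) := by
    refine antitoneOn_of_deriv_nonpos (convex_Ici 0)
      (fun y _ => (hd y).continuousAt.continuousWithinAt)
      (fun y _ => (hd y).differentiableAt.differentiableWithinAt) fun y hy => ?_
    rw [interior_Ici] at hy
    rw [(hd y).deriv]
    have h := deriv_partialRatio_le h0 h1 (le_of_lt hy) N
    have he := (Real.exp_pos (-(primitiveRatio q N y - primitiveRatio q N (q * y)))).le
    have := mul_le_mul_of_nonneg_right h he
    simp only [Pi.sub_apply, Pi.neg_apply, Function.comp_apply, mul_one] at *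
    nlinarith
  have h := hanti (mem_Ici.2 le_rfl) (mem_Ici.2 hx) hx
  have hf0 : f 0 = 1 := by
    simp [hf, partialRatio, primitiveRatio, Finset.sum_range_succ', ratioCoeff_zero]
  rw [hf0, hf] at h
  simp only [Real.exp_neg] at h
  rwa [← div_eq_mul_inv, div_le_one (Real.exp_pos _)] at h

/-- Termwise Bernoulli inequality, `1 - q^(k+1) ≤ (k+1)(1 - q)`. -/
theorem primitiveRatio_sub_le {q x : ℝ} (h0 : 0 ≤ q) (h1 : q ≤ 1) (hx : 0 ≤ x) (N : ℕ) :
    primitiveRatio q N x - primitiveRatio q N (q * x) ≤ (1 - q) * x * partialRatio q N x := by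
  rw [primitiveRatio, primitiveRatio, partialRatio, ← Finset.sum_sub_distrib, Finset.mul_sum]
  refine Finset.sum_le_sum fun k _ => ?_
  have hb : 1 - q ^ (k + 1) ≤ (k + 1) * (1 - q) := by
    have := one_add_mul_le_pow (a := q - 1) (by linarith) (k + 1)
    push_cast at this
    rw [show 1 + (q - 1) = q by ring] at this
    linarith
  have hk : (0 : ℝ) < k + 1 := by positivity
  have e : ratioCoeff q k / (k + 1) * x ^ (k + 1) - ratioCoeff q k / (k + 1) * (q * x) ^ (k + 1) =
      ratioCoeff q k * x ^ (k + 1) * ((1 - q ^ (k + 1)) / (k + 1)) := by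
    rw [mul_pow]; ring
  have e' : (1 - q) * x * (ratioCoeff q k * x ^ k) = ratioCoeff q k * x ^ (k + 1) * (1 - q) := by
    ring
  rw [e, e']
  refine mul_le_mul_of_nonneg_left ?_
    (mul_nonneg (ratioCoeff_nonneg h0 h1 k) (pow_nonneg hx _))
  rw [div_le_iff₀ hk]
  linarith

/-- The value `e` is preserved by the induction: if `(1 - q) x ≤ 1/e` and `S_N ≤ e`, then `S_(N+1) ≤
exp (e⁻¹ e) = e`. -/
theorem partialRatio_le_exp_one {q x : ℝ} (h0 : 0 ≤ q) (h1 : q ≤ 1) (hx : 0 ≤ x)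
    (hx1 : (1 - q) * x ≤ 1 / Real.exp 1) (N : ℕ) : partialRatio q N x ≤ Real.exp 1 := by
  induction N with
  | zero => simpa [partialRatio] using (Real.exp_pos 1).le
  | succ N ih =>
    refine (partialRatio_succ_le_exp h0 h1 hx N).trans (Real.exp_le_exp.2 ?_)
    refine (primitiveRatio_sub_le h0 h1 hx N).trans ?_
    calc _ ≤ 1 / Real.exp 1 * Real.exp 1 :=
          mul_le_mul hx1 ih (partialRatio_nonneg h0 h1 hx N) (by positivity)
      _ = 1 := by field_simp

theorem summable_ratio_of_bounded {q x C : ℝ} (h0 : 0 ≤ q) (h1 : q ≤ 1) (hx : 0 ≤ x)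
    (h : ∀ N, partialRatio q N x ≤ C) : Summable fun k => ratioCoeff q k * x ^ k :=
  summable_of_sum_range_le
    (fun k => mul_nonneg (ratioCoeff_nonneg h0 h1 k) (pow_nonneg hx k)) h

theorem mul_lt_one_of_summable_ratio {q x : ℝ} (h0 : 0 ≤ q) (h1 : q < 1) (hx : 0 ≤ x)
    (h : Summable fun k => ratioCoeff q k * x ^ k) : (1 - q) * x < 1 := by
  have hy : 0 ≤ (1 - q) * x := mul_nonneg (by linarith) hx
  have hs : Summable fun k => ((1 - q) * x) ^ k := by
    refine Summable.of_nonneg_of_le (fun k => pow_nonneg hy k) (fun k => ?_) h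
    rw [ratioCoeff_eq h1, mul_assoc, ← mul_pow]
    exact le_mul_of_one_le_left (pow_nonneg hy k) (one_le_normCoeff h0 h1 k)
  have := summable_geometric_iff_norm_lt_one.1 hs
  rwa [Real.norm_of_nonneg hy] at this

/-! ### The function `ψ` on the half-line and the convergence of the ratio series -/

/-- The sum `ψ(x) = ∑ (-1)^n q^{n(n-1)/2} x^n / n!`. -/
def psi (q x : ℝ) : ℝ := ∑' n, PowerSeries.coeff n (altExp q) * x ^ n

theorem norm_coeff_altExp_le {q : ℝ} (h0 : 0 ≤ q) (h1 : q ≤ 1) (n : ℕ) :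
    ‖PowerSeries.coeff n (altExp q)‖ ≤ 1 / (n.factorial : ℝ) := by
  simp only [altExp, PowerSeries.coeff_mk, norm_div, norm_mul, norm_pow, norm_neg, norm_one,
    one_pow, one_mul, Real.norm_of_nonneg h0, RCLike.norm_natCast]
  gcongr
  exact pow_le_one₀ h0 h1

theorem summable_norm_psi {q : ℝ} (h0 : 0 ≤ q) (h1 : q ≤ 1) (x : ℝ) :
    Summable fun n => ‖PowerSeries.coeff n (altExp q) * x ^ n‖ := by
  refine Summable.of_nonneg_of_le (fun n => norm_nonneg _) (fun n => ?_)
    (Real.summable_pow_div_factorial |x|)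
  rw [norm_mul, norm_pow, Real.norm_eq_abs x, div_eq_mul_one_div, mul_comm]
  exact mul_le_mul_of_nonneg_left (norm_coeff_altExp_le h0 h1 n) (by positivity)

theorem psi_zero (q : ℝ) : psi q 0 = 1 := by
  rw [psi, tsum_eq_single 0 fun n hn => by simp [hn]]
  simp [constantCoeff_altExp]

theorem tsum_rescale_altExp (q x : ℝ) :
    ∑' n, PowerSeries.coeff n (PowerSeries.rescale q (altExp q)) * x ^ n = psi q (q * x) := by
  rw [psi]
  refine tsum_congr fun n => ?_
  rw [PowerSeries.coeff_rescale, mul_pow]; ring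

theorem hasDerivAt_psi {q : ℝ} (h0 : 0 ≤ q) (h1 : q ≤ 1) (x : ℝ) :
    HasDerivAt (psi q) (-psi q (q * x)) x := by
  set R : ℝ := |x| + 1 with hR
  have hR0 : 0 ≤ R := by positivity
  have hu : Summable fun n : ℕ => (n : ℝ) * (R ^ (n - 1) / n.factorial) := by
    rw [← summable_nat_add_iff 1]
    refine (Real.summable_pow_div_factorial R).congr fun n => ?_
    have : (n + 1 : ℝ) ≠ 0 := by positivity
    have : (n.factorial : ℝ) ≠ 0 := by positivity
    simp only [Nat.add_sub_cancel, Nat.factorial_succ]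
    push_cast
    field_simp
  have h := hasDerivAt_tsum_of_isPreconnected (t := Metric.ball (0 : ℝ) R) (y₀ := 0) (y := x)
    (g := fun n y => PowerSeries.coeff n (altExp q) * y ^ n)
    (g' := fun n y => PowerSeries.coeff n (altExp q) * (n * y ^ (n - 1)))
    hu Metric.isOpen_ball (convex_ball (0 : ℝ) R).isPreconnected
    (fun n y _ => (hasDerivAt_pow n y).const_mul _) ?_ ?_ ?_ ?_
  · convert! h using 1
    rw [Summable.tsum_eq_zero_add]
    · simp only [Nat.cast_zero, zero_mul, mul_zero, zero_add, Nat.add_sub_cancel]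
      rw [← tsum_rescale_altExp, ← tsum_neg]
      refine tsum_congr fun n => ?_
      have hd := congrArg (PowerSeries.coeff n) (derivative_altExp q)
      rw [PowerSeries.coeff_derivative, map_neg] at hd
      rw [← neg_mul, ← hd]
      push_cast
      ring
    · rw [← summable_nat_add_iff 1]
      have hs := (summable_norm_psi h0 h1 (q * x)).of_norm.neg
      refine hs.congr fun n => ?_
      have hd := congrArg (PowerSeries.coeff n) (derivative_altExp q)
      rw [PowerSeries.coeff_derivative, map_neg, PowerSeries.coeff_rescale] at hd
      simp only [Nat.add_sub_cancel, mul_pow]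
      push_cast
      linear_combination (-x ^ n) * hd
  · intro n y hy
    rw [mem_ball_zero_iff, Real.norm_eq_abs] at hy
    have := norm_coeff_altExp_le h0 h1 n
    rw [norm_mul, norm_mul, norm_pow, RCLike.norm_natCast, Real.norm_eq_abs y]
    calc _ ≤ 1 / (n.factorial : ℝ) * (n * R ^ (n - 1)) := by gcongr
      _ = _ := by ring
  · simp [hR]; positivity
  · exact (summable_norm_psi h0 h1 0).of_norm
  · simp [hR]

theorem continuous_psi {q : ℝ} (h0 : 0 ≤ q) (h1 : q ≤ 1) : Continuous (psi q) :=
  continuous_iff_continuousAt.2 fun x => (hasDerivAt_psi h0 h1 x).continuousAt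

theorem antitoneOn_psi {q X : ℝ} (h0 : 0 ≤ q) (h1 : q ≤ 1)
    (hpos : ∀ y, 0 ≤ y → y < X → 0 < psi q y) : AntitoneOn (psi q) (Icc 0 X) := by
  refine antitoneOn_of_deriv_nonpos (convex_Icc 0 X) (continuous_psi h0 h1).continuousOn
    (fun y _ => (hasDerivAt_psi h0 h1 y).differentiableAt.differentiableWithinAt) fun y hy => ?_
  rw [interior_Icc] at hy
  rw [(hasDerivAt_psi h0 h1 y).deriv, neg_nonpos]
  exact (hpos _ (mul_nonneg h0 hy.1.le)
    ((mul_le_of_le_one_left hy.1.le h1).trans_lt hy.2)).le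

/-- While `ψ` stays positive it decreases from `ψ(0) = 1`, so `ψ'(y) = -ψ(q y) ≥ -1`. -/
theorem one_sub_le_psi {q X : ℝ} (h0 : 0 ≤ q) (h1 : q ≤ 1) (hX : 0 ≤ X)
    (hpos : ∀ y, 0 ≤ y → y < X → 0 < psi q y) : 1 - X ≤ psi q X := by
  have hanti := antitoneOn_psi h0 h1 hpos
  have hmono : MonotoneOn (fun y => psi q y + y) (Icc 0 X) := by
    have hd : ∀ y, HasDerivAt (fun y => psi q y + y) (-psi q (q * y) + 1) y := fun y =>
      (hasDerivAt_psi h0 h1 y).add (hasDerivAt_id y)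
    refine monotoneOn_of_deriv_nonneg (convex_Icc 0 X)
      (fun y _ => (hd y).continuousAt.continuousWithinAt)
      (fun y _ => (hd y).differentiableAt.differentiableWithinAt) fun y hy => ?_
    rw [interior_Icc] at hy
    rw [(hd y).deriv]
    have h := hanti (left_mem_Icc.2 hX) ⟨mul_nonneg h0 hy.1.le,
      (mul_le_of_le_one_left hy.1.le h1).trans hy.2.le⟩ (mul_nonneg h0 hy.1.le)
    rw [psi_zero] at h
    linarith
  have h := hmono (left_mem_Icc.2 hX) (right_mem_Icc.2 hX) hX
  simp only [psi_zero] at h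
  linarith

theorem tsum_ratio_mul_psi {q x : ℝ} (h0 : 0 ≤ q) (h1 : q ≤ 1) (hx : 0 ≤ x)
    (hs : Summable fun k => ratioCoeff q k * x ^ k) :
    psi q x * ∑' k, ratioCoeff q k * x ^ k = psi q (q * x) := by
  have hs' : Summable fun k => ‖ratioCoeff q k * x ^ k‖ := by
    refine hs.congr fun k => ?_
    rw [Real.norm_of_nonneg (mul_nonneg (ratioCoeff_nonneg h0 h1 k) (pow_nonneg hx k))]
  rw [psi, tsum_mul_tsum_eq_tsum_sum_antidiagonal_of_summable_norm
    (summable_norm_psi h0 h1 x) hs', ← tsum_rescale_altExp]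
  refine tsum_congr fun n => ?_
  rw [← altExp_mul_ratioSeries, PowerSeries.coeff_mul, Finset.sum_mul]
  refine Finset.sum_congr rfl fun p hp => ?_
  rw [← Finset.HasAntidiagonal.mem_antidiagonal.1 hp, ratioCoeff, pow_add]
  ring

/-- Induction on `N`: the hypothesis says that the primitive of `S_N` grows no faster than `-log ψ`,
since `(log ψ)' = -ψ(q ·)/ψ`. Integrating over `[q x, x]` and exponentiating bounds `S_(N+1)`.
Positivity of `ψ` on the real interval thus gives convergence without complex analysis. -/
theorem partialRatio_le_psi_div {q X : ℝ} (h0 : 0 ≤ q) (h1 : q ≤ 1)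
    (hpos : ∀ y, 0 ≤ y → y < X → 0 < psi q y) (N : ℕ) :
    ∀ x, 0 ≤ x → x < X → partialRatio q N x ≤ psi q (q * x) / psi q x := by
  have hqx : ∀ x, 0 ≤ x → x < X → q * x < X := fun x h2 h3 =>
    (mul_le_of_le_one_left h2 h1).trans_lt h3
  induction N with
  | zero =>
    intro x h2 h3
    simpa [partialRatio] using
      (div_pos (hpos _ (mul_nonneg h0 h2) (hqx x h2 h3)) (hpos x h2 h3)).le
  | succ N ih =>
    intro x h2 h3
    refine (partialRatio_succ_le_exp h0 h1 h2 N).trans ?_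
    have hd : ∀ y, 0 ≤ y → y < X → HasDerivAt (fun y => primitiveRatio q N y + Real.log (psi q y))
        (partialRatio q N y + -psi q (q * y) / psi q y) y := fun y h4 h5 =>
      (hasDerivAt_primitiveRatio q N y).add
        ((hasDerivAt_psi h0 h1 y).log (hpos y h4 h5).ne')
    have hanti : AntitoneOn (fun y => primitiveRatio q N y + Real.log (psi q y)) (Icc 0 x) := by
      refine antitoneOn_of_deriv_nonpos (convex_Icc 0 x)
        (fun y hy => (hd y hy.1 (hy.2.trans_lt h3)).continuousAt.continuousWithinAt)
        (fun y hy => ?_) fun y hy => ?_ <;> rw [interior_Icc] at hy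
      · exact (hd y hy.1.le (hy.2.trans h3)).differentiableAt.differentiableWithinAt
      · rw [(hd y hy.1.le (hy.2.trans h3)).deriv, neg_div]
        have := ih y hy.1.le (hy.2.trans h3)
        linarith
    have h := hanti ⟨mul_nonneg h0 h2, mul_le_of_le_one_left h2 h1⟩ (right_mem_Icc.2 h2)
      (mul_le_of_le_one_left h2 h1)
    have hp1 := hpos _ (mul_nonneg h0 h2) (hqx x h2 h3)
    have hp2 := hpos x h2 h3
    rw [← Real.exp_log (div_pos hp1 hp2), Real.exp_le_exp, Real.log_div hp1.ne' hp2.ne']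
    simp only at h
    linarith

theorem summable_ratio_of_psi_pos {q X x : ℝ} (h0 : 0 ≤ q) (h1 : q ≤ 1)
    (hpos : ∀ y, 0 ≤ y → y < X → 0 < psi q y) (hx : 0 ≤ x) (hxX : x < X) :
    Summable fun k => ratioCoeff q k * x ^ k :=
  summable_ratio_of_bounded h0 h1 hx fun N => partialRatio_le_psi_div h0 h1 hpos N x hx hxX

/-! ### The first zero of `ψ` as the radius of convergence of the ratio series -/

/-- The smallest positive zero of `ψ`. -/
def firstZero (q : ℝ) : ℝ := sInf {x | 0 ≤ x ∧ psi q x = 0}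

/-- If `ψ` never vanished it would be positive on `[0, ∞)`, and the ratio series would converge at
`1 / (1 - q)`, where it dominates `∑ 1`. -/
theorem exists_psi_eq_zero {q : ℝ} (h0 : 0 ≤ q) (h1 : q < 1) : ∃ x, 0 ≤ x ∧ psi q x = 0 := by
  by_contra! hne
  have hpos : ∀ x, 0 ≤ x → 0 < psi q x := by
    intro x hx
    by_contra! hle
    obtain ⟨y, hy, hy0⟩ := intermediate_value_Icc' hx (continuous_psi h0 h1.le).continuousOn
      (show (0 : ℝ) ∈ Icc (psi q x) (psi q 0) from ⟨hle, by simp [psi_zero]⟩)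
    exact hne y hy.1 hy0
  have h2 : 0 < 1 - q := by linarith
  have hx : 0 ≤ 1 / (1 - q) := by positivity
  have h := mul_lt_one_of_summable_ratio h0 h1 hx
    (summable_ratio_of_psi_pos (X := 1 / (1 - q) + 1) h0 h1.le (fun y hy _ => hpos y hy) hx
      (by linarith))
  rw [mul_one_div_cancel h2.ne'] at h
  exact lt_irrefl _ h

theorem firstZero_mem {q : ℝ} (h0 : 0 ≤ q) (h1 : q < 1) :
    firstZero q ∈ {x | 0 ≤ x ∧ psi q x = 0} := by
  refine IsClosed.csInf_mem ?_ (exists_psi_eq_zero h0 h1) ⟨0, fun x hx => hx.1⟩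
  exact (isClosed_le continuous_const continuous_id).inter
    (isClosed_eq (continuous_psi h0 h1.le) continuous_const)

theorem psi_firstZero {q : ℝ} (h0 : 0 ≤ q) (h1 : q < 1) : psi q (firstZero q) = 0 :=
  (firstZero_mem h0 h1).2

theorem psi_pos_of_lt_firstZero {q : ℝ} (h0 : 0 ≤ q) (h1 : q < 1) :
    ∀ x, 0 ≤ x → x < firstZero q → 0 < psi q x := by
  intro x hx hlt
  by_contra! hle
  obtain ⟨y, hy, hy0⟩ := intermediate_value_Icc' hx (continuous_psi h0 h1.le).continuousOn
    (show (0 : ℝ) ∈ Icc (psi q x) (psi q 0) from ⟨hle, by simp [psi_zero]⟩)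
  have : firstZero q ≤ y := csInf_le ⟨0, fun x hx => hx.1⟩ ⟨hy.1, hy0⟩
  linarith [hy.2]

theorem one_le_firstZero {q : ℝ} (h0 : 0 ≤ q) (h1 : q < 1) : 1 ≤ firstZero q := by
  have h := one_sub_le_psi h0 h1.le (firstZero_mem h0 h1).1 (psi_pos_of_lt_firstZero h0 h1)
  rw [psi_firstZero h0 h1] at h
  linarith

/-- Convergence at or beyond `Z` would give convergence at `Z`, and then `ψ(Z) G(Z) = ψ(q Z)` would
read `0 = ψ(q Z) > 0`. So the endpoint itself is excluded, which later yields strict inequalities.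
-/
theorem summable_ratio_iff {q x : ℝ} (h0 : 0 ≤ q) (h1 : q < 1) (hx : 0 ≤ x) :
    (Summable fun k => ratioCoeff q k * x ^ k) ↔ x < firstZero q := by
  refine ⟨fun hs => ?_, summable_ratio_of_psi_pos h0 h1.le (psi_pos_of_lt_firstZero h0 h1) hx⟩
  by_contra! hle
  have hZ := one_le_firstZero h0 h1
  have hZ0 : 0 ≤ firstZero q := by linarith
  have hs' : Summable fun k => ratioCoeff q k * firstZero q ^ k :=
    Summable.of_nonneg_of_le
      (fun k => mul_nonneg (ratioCoeff_nonneg h0 h1.le k) (pow_nonneg hZ0 k))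
      (fun k => mul_le_mul_of_nonneg_left (pow_le_pow_left₀ hZ0 hle k)
        (ratioCoeff_nonneg h0 h1.le k)) hs
  have h := tsum_ratio_mul_psi h0 h1.le hZ0 hs'
  rw [psi_firstZero h0 h1, zero_mul] at h
  have := psi_pos_of_lt_firstZero h0 h1 (q * firstZero q) (mul_nonneg h0 hZ0)
    (mul_lt_of_lt_one_left (by linarith) h1)
  linarith

/-! ### Bounds and strict monotonicity of the normalized zero -/

/-- The normalized first zero `(1 - q) Z(q)` of `ψ`. -/
def normZero (q : ℝ) : ℝ := (1 - q) * firstZero q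

theorem one_sub_le_normZero {q : ℝ} (h0 : 0 ≤ q) (h1 : q < 1) : 1 - q ≤ normZero q :=
  le_mul_of_one_le_right (by linarith) (one_le_firstZero h0 h1)

theorem normZero_le_one {q : ℝ} (h0 : 0 ≤ q) (h1 : q < 1) : normZero q ≤ 1 := by
  by_contra! h
  have h2 : 0 < 1 - q := by linarith
  have hx : 0 ≤ 1 / (1 - q) := by positivity
  have h3 := mul_lt_one_of_summable_ratio h0 h1 hx ((summable_ratio_iff h0 h1 hx).2 (by
    rw [div_lt_iff₀ h2, mul_comm]; exact h))
  rw [mul_one_div_cancel h2.ne'] at h3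
  exact lt_irrefl _ h3

/-- Strict because the partial sums remain bounded at `(1 - q) x = 1/e` itself, while the series
diverges at the zero. -/
theorem inv_exp_lt_normZero {q : ℝ} (h0 : 0 ≤ q) (h1 : q < 1) : 1 / Real.exp 1 < normZero q := by
  have h2 : 0 < 1 - q := by linarith
  have hx : 0 ≤ 1 / Real.exp 1 / (1 - q) := by positivity
  have h := (summable_ratio_iff h0 h1 hx).1 (summable_ratio_of_bounded h0 h1.le hx
    (partialRatio_le_exp_one h0 h1.le hx (by rw [mul_div_cancel₀ _ h2.ne'])))
  rwa [div_lt_iff₀ h2, mul_comm] at h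

theorem summable_normCoeff_iff {q u : ℝ} (h0 : 0 ≤ q) (h1 : q < 1) (hu : 0 ≤ u) :
    (Summable fun k => normCoeff q k * u ^ k) ↔ u < normZero q := by
  have h2 : 0 < 1 - q := by linarith
  have h := summable_ratio_iff h0 h1 (div_nonneg hu h2.le)
  rw [div_lt_iff₀ h2, mul_comm (firstZero q)] at h
  rw [normZero, ← h]
  refine summable_congr fun k => ?_
  rw [normCoeff, div_pow]; ring

theorem normZero_anti {q r : ℝ} (h0 : 0 ≤ q) (hqr : q ≤ r) (h1 : r < 1) :
    normZero r ≤ normZero q := by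
  by_contra! hlt
  have hu : 0 ≤ normZero q := (by positivity : 0 ≤ 1 / Real.exp 1).trans
    (inv_exp_lt_normZero h0 (hqr.trans_lt h1)).le
  have hs := (summable_normCoeff_iff (h0.trans hqr) h1 hu).2 hlt
  refine lt_irrefl _ ((summable_normCoeff_iff h0 (hqr.trans_lt h1) hu).1 ?_)
  exact Summable.of_nonneg_of_le
    (fun k => mul_nonneg (normCoeff_nonneg h0 (hqr.trans h1.le) k) (pow_nonneg hu k))
    (fun k => mul_le_mul_of_nonneg_right (normCoeff_mono h0 hqr h1 k) (pow_nonneg hu k)) hs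

theorem tsum_normCoeff {q u : ℝ} (h0 : 0 ≤ q) (h1 : q < 1) (hu : 0 ≤ u) (hu1 : u < normZero q) :
    ∑' k, normCoeff q k * u ^ k = psi q (q * (u / (1 - q))) / psi q (u / (1 - q)) := by
  have h2 : 0 < 1 - q := by linarith
  have hlt : u / (1 - q) < firstZero q := by rw [div_lt_iff₀ h2, mul_comm]; exact hu1
  have hx := div_nonneg hu h2.le
  rw [eq_div_iff (psi_pos_of_lt_firstZero h0 h1 _ hx hlt).ne',
    ← tsum_ratio_mul_psi h0 h1.le hx ((summable_ratio_iff h0 h1 hx).2 hlt), mul_comm]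
  congr 1
  refine tsum_congr fun k => ?_
  rw [normCoeff, div_pow]; ring

/-- The zero is simple and `ψ'(Z) = -ψ(q Z)` cancels the numerator of `ψ(q x)/ψ(x)`, so `(Z - x)
G(x) → 1`. The factor `1 - q` is the change of variable `u = (1 - q) x`. -/
theorem tendsto_mul_tsum_normCoeff {q : ℝ} (h0 : 0 ≤ q) (h1 : q < 1) :
    Tendsto (fun u => (normZero q - u) * ∑' k, normCoeff q k * u ^ k) (𝓝[<] normZero q)
      (𝓝 (1 - q)) := by
  have h2 : 0 < 1 - q := by linarith
  set Z := firstZero q with hZ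
  have hZ1 : 1 ≤ Z := one_le_firstZero h0 h1
  have hp : 0 < psi q (q * Z) := psi_pos_of_lt_firstZero h0 h1 (q * Z)
    (mul_nonneg h0 (by linarith)) (mul_lt_of_lt_one_left (by linarith) h1)
  have hslope := (hasDerivAt_iff_tendsto_slope.1 (hasDerivAt_psi h0 h1.le Z)).mono_left
    (nhdsWithin_mono Z (fun y (hy : y < Z) => hy.ne) : 𝓝[<] Z ≤ _)
  have hnum : Tendsto (fun x => psi q (q * x)) (𝓝[<] Z) (𝓝 (psi q (q * Z))) :=
    (((continuous_psi h0 h1.le).comp (continuous_const.mul continuous_id)).tendsto Z).mono_left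
      nhdsWithin_le_nhds
  have hlim := ((hnum.div hslope (neg_ne_zero.2 hp.ne')).const_mul (-(1 - q)))
  have hscale : Tendsto (fun u => u / (1 - q)) (𝓝[<] normZero q) (𝓝[<] Z) := by
    refine tendsto_nhdsWithin_iff.2 ⟨?_, ?_⟩
    · have : Tendsto (fun u => u / (1 - q)) (𝓝 (normZero q)) (𝓝 (normZero q / (1 - q))) :=
        (continuous_id.div_const _).tendsto _
      rw [normZero, mul_div_cancel_left₀ _ h2.ne'] at this
      exact this.mono_left nhdsWithin_le_nhds
    · filter_upwards [self_mem_nhdsWithin] with u hu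
      rw [mem_Iio, div_lt_iff₀ h2, mul_comm]
      exact hu
  have hlim' := hlim.comp hscale
  have e : -(1 - q) * (psi q (q * Z) / -psi q (q * Z)) = 1 - q := by
    field_simp
  rw [e] at hlim'
  refine hlim'.congr' ?_
  have hN : 0 < normZero q := mul_pos h2 (by linarith)
  filter_upwards [self_mem_nhdsWithin, mem_nhdsWithin_of_mem_nhds (lt_mem_nhds hN)] with u hu hu0
  have hu' : u < normZero q := hu
  rw [tsum_normCoeff h0 h1 (le_of_lt hu0) hu']
  have hx0 : 0 ≤ u / (1 - q) := div_nonneg (le_of_lt hu0) h2.le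
  have hxZ : u / (1 - q) < Z := by rw [div_lt_iff₀ h2, mul_comm]; exact hu'
  have hpx := psi_pos_of_lt_firstZero h0 h1 _ hx0 hxZ
  have hne : u / (1 - q) - Z ≠ 0 := by linarith
  simp only [Function.comp_apply, slope_def_field, Pi.div_apply]
  rw [hZ, psi_firstZero h0 h1, ← hZ, sub_zero]
  have e2 : normZero q - u = -(1 - q) * (u / (1 - q) - Z) := by
    rw [normZero, ← hZ]; field_simp; ring
  rw [e2]
  field_simp

theorem normZero_strictAnti {q r : ℝ} (h0 : 0 ≤ q) (hqr : q < r) (h1 : r < 1) :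
    normZero r < normZero q := by
  refine (normZero_anti h0 hqr.le h1).lt_of_ne fun heq => ?_
  have hq := tendsto_mul_tsum_normCoeff h0 (hqr.trans h1)
  have hr := tendsto_mul_tsum_normCoeff (h0.trans hqr.le) h1
  rw [heq] at hr
  have hN : 0 < normZero q := (by positivity : 0 < 1 / Real.exp 1).trans
    (inv_exp_lt_normZero h0 (hqr.trans h1))
  -- At a common pole, the larger coefficients for `r` would force the larger pole strength,
  -- although `1 - r < 1 - q`.
  have : 1 - q ≤ 1 - r := by
    refine le_of_tendsto_of_tendsto hq hr ?_
    filter_upwards [self_mem_nhdsWithin, mem_nhdsWithin_of_mem_nhds (lt_mem_nhds hN)] with u hu hu0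
    have hu' : u < normZero q := hu
    have hu0' : 0 ≤ u := le_of_lt hu0
    refine mul_le_mul_of_nonneg_left ?_ (by linarith)
    exact Summable.tsum_le_tsum
      (fun k => mul_le_mul_of_nonneg_right (normCoeff_mono h0 hqr.le h1 k) (pow_nonneg hu0' k))
      ((summable_normCoeff_iff h0 (hqr.trans h1) hu0').2 hu')
      ((summable_normCoeff_iff (h0.trans hqr.le) h1 hu0').2 (by rw [heq]; exact hu'))
  linarith

/-! ### The limits of the normalized zero as `q → 1` and `q → 0` -/

/-- Bootstrap for the delay equation: `ψ(q y) ≥ m ψ(y)` means `ψ' ≤ -m ψ`, so integrating over `[q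
x, x]` improves the factor to `exp (m (1 - q) x) ≥ e m u`. The factor `q^K` in the hypothesis on `u`
pays for the `K` passages from `x` to points as small as `q x`. -/
theorem pow_mul_psi_le {q X u : ℝ} (h0 : 0 < q) (h1 : q ≤ 1) (hu : 0 < u)
    (hpos : ∀ y, 0 ≤ y → y < X → 0 < psi q y) (K : ℕ) :
    ∀ x, 0 ≤ x → x < X → u ≤ q ^ K * ((1 - q) * x) →
      (Real.exp 1 * u) ^ K * psi q x ≤ psi q (q * x) := by
  induction K with
  | zero =>
    intro x hx hxX _
    have hle := mul_le_of_le_one_left hx h1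
    have := antitoneOn_psi h0.le h1 hpos ⟨mul_nonneg h0.le hx, hle.trans hxX.le⟩ ⟨hx, hxX.le⟩ hle
    simpa using this
  | succ K ih =>
    intro x hx hxX hux
    set m := (Real.exp 1 * u) ^ K with hm
    have hm0 : 0 ≤ m := by positivity
    have hle := mul_le_of_le_one_left hx h1
    have hqx : 0 ≤ q * x := mul_nonneg h0.le hx
    have h1q : 0 ≤ 1 - q := by linarith
    have hd : ∀ y, HasDerivAt (fun y => psi q y * Real.exp (m * y))
        (-psi q (q * y) * Real.exp (m * y) + psi q y * (Real.exp (m * y) * (m * 1))) y := fun y =>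
      (hasDerivAt_psi h0.le h1 y).mul ((hasDerivAt_id y).const_mul m).exp
    have hanti : AntitoneOn (fun y => psi q y * Real.exp (m * y)) (Icc (q * x) x) := by
      refine antitoneOn_of_deriv_nonpos (convex_Icc _ _)
        (fun y _ => (hd y).continuousAt.continuousWithinAt)
        (fun y _ => (hd y).differentiableAt.differentiableWithinAt) fun y hy => ?_
      rw [interior_Icc] at hy
      rw [(hd y).deriv]
      have hy1 : u ≤ q ^ K * ((1 - q) * y) := by
        refine hux.trans ?_
        rw [pow_succ, mul_assoc]
        refine mul_le_mul_of_nonneg_left ?_ (by positivity)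
        calc q * ((1 - q) * x) = (1 - q) * (q * x) := by ring
          _ ≤ _ := mul_le_mul_of_nonneg_left hy.1.le h1q
      have h := ih y (hqx.trans hy.1.le) (hy.2.trans hxX) hy1
      have := mul_le_mul_of_nonneg_right h (Real.exp_pos (m * y)).le
      linarith
    have h := hanti ⟨le_rfl, hle⟩ ⟨hle, le_rfl⟩ hle
    simp only at h
    have hx1 : u ≤ (1 - q) * x := hux.trans
      (mul_le_of_le_one_left (mul_nonneg h1q hx) (pow_le_one₀ h0.le h1))
    have hexp : Real.exp 1 * u * m * Real.exp (m * (q * x)) ≤ Real.exp (m * x) := by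
      -- The split isolates `exp (s - 1) ≥ s` with `s = m (1 - q) x`, that is, `exp s ≥ e s`.
      have e1 : m * x = (m * ((1 - q) * x) - 1) + 1 + m * (q * x) := by ring
      rw [e1, Real.exp_add, Real.exp_add]
      refine mul_le_mul_of_nonneg_right ?_ (Real.exp_pos _).le
      have h3 := Real.add_one_le_exp (m * ((1 - q) * x) - 1)
      have h4 : m * u ≤ m * ((1 - q) * x) := mul_le_mul_of_nonneg_left hx1 hm0
      have h5 : m * u ≤ Real.exp (m * ((1 - q) * x) - 1) := by linarith
      have := mul_le_mul_of_nonneg_right h5 (Real.exp_pos 1).le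
      linarith
    have hp := hpos x hx hxX
    refine le_of_mul_le_mul_right ?_ (Real.exp_pos (m * (q * x)))
    calc _ = psi q x * (Real.exp 1 * u * m * Real.exp (m * (q * x))) := by rw [pow_succ, ← hm]; ring
      _ ≤ psi q x * Real.exp (m * x) := mul_le_mul_of_nonneg_left hexp hp.le
      _ ≤ _ := h

theorem mul_psi_le_sub {q X a b : ℝ} (h0 : 0 ≤ q) (h1 : q ≤ 1)
    (hpos : ∀ y, 0 ≤ y → y < X → 0 < psi q y) (ha : 0 ≤ a) (hab : a ≤ b) (hb : b ≤ X) :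
    (b - a) * psi q (q * b) ≤ psi q a - psi q b := by
  have hanti := antitoneOn_psi h0 h1 hpos
  have hd : ∀ y, HasDerivAt (fun y => psi q y + y * psi q (q * b))
      (-psi q (q * y) + 1 * psi q (q * b)) y := fun y =>
    (hasDerivAt_psi h0 h1 y).add ((hasDerivAt_id y).mul_const _)
  have hA : AntitoneOn (fun y => psi q y + y * psi q (q * b)) (Icc a b) := by
    refine antitoneOn_of_deriv_nonpos (convex_Icc _ _)
      (fun y _ => (hd y).continuousAt.continuousWithinAt)
      (fun y _ => (hd y).differentiableAt.differentiableWithinAt) fun y hy => ?_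
    rw [interior_Icc] at hy
    rw [(hd y).deriv]
    have hy0 : 0 ≤ y := ha.trans hy.1.le
    have hb0 : 0 ≤ b := ha.trans hab
    have := hanti ⟨mul_nonneg h0 hy0, (mul_le_of_le_one_left hy0 h1).trans (hy.2.le.trans hb)⟩
      ⟨mul_nonneg h0 hb0, (mul_le_of_le_one_left hb0 h1).trans hb⟩
      (mul_le_mul_of_nonneg_left hy.2.le h0)
    linarith
  have h := hA ⟨le_rfl, hab⟩ ⟨hab, le_rfl⟩ hab
  simp only at h
  linarith

/-- The opposite estimate, with a constant independent of `K`: a positive `ψ` cannot drop too fast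
from `q² X` to `q X`, because the values of `ψ` at earlier points dictate the later decrease. -/
theorem sq_mul_psi_le {q X : ℝ} (h0 : 0 < q) (h1 : q ≤ 1) (hX : 0 ≤ X)
    (hpos : ∀ y, 0 ≤ y → y ≤ X → 0 < psi q y) :
    ((1 - q) * (q * X) / 2) ^ 2 * psi q (q * (q * X)) ≤ psi q (q * X) := by
  have hpos' : ∀ y, 0 ≤ y → y < X → 0 < psi q y := fun y h2 h3 => hpos y h2 h3.le
  have h1q : 0 ≤ 1 - q := by linarith
  have hqX : 0 ≤ q * X := mul_nonneg h0.le hX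
  have hqqX : 0 ≤ q * (q * X) := mul_nonneg h0.le hqX
  have hw : 0 ≤ (1 - q) * X := mul_nonneg h1q hX
  have hw' : 0 ≤ (1 - q) * (q * X) := mul_nonneg h1q hqX
  have hww : (1 - q) * (q * X) ≤ (1 - q) * X :=
    mul_le_mul_of_nonneg_left (mul_le_of_le_one_left hX h1) h1q
  -- `s` is the midpoint of `[q X, X]` and `q s` that of `[q² X, q X]`; the decrease over `[q s, q
  -- X]` compares `ψ(q² X)` with `ψ(q s)`, and the decrease over `[q X, s]` compares `ψ(q s)` with
  -- `ψ(q X)`.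
  set s := (1 + q) * X / 2 with hs
  have hsX : s ≤ X := by linarith
  have hs0 : 0 ≤ s := by positivity
  have ha := mul_psi_le_sub h0.le h1 hpos' hqX (by linarith : q * X ≤ s) hsX
  have e : q * s = q * (q * X) + (1 - q) * (q * X) / 2 := by rw [hs]; ring
  have hb := mul_psi_le_sub h0.le h1 hpos' (by rw [e]; positivity : 0 ≤ q * s)
    (by rw [e]; linarith : q * s ≤ q * X) (mul_le_of_le_one_left hX h1)
  have p1 := hpos s hs0 hsX
  have p2 := hpos (q * X) hqX (mul_le_of_le_one_left hX h1)
  have p3 := hpos (q * s) (mul_nonneg h0.le hs0) ((mul_le_of_le_one_left hs0 h1).trans hsX)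
  have e1 : s - q * X = (1 - q) * X / 2 := by rw [hs]; ring
  have e2 : q * X - q * s = (1 - q) * (q * X) / 2 := by rw [hs]; ring
  rw [e1] at ha
  rw [e2] at hb
  calc _ = (1 - q) * (q * X) / 2 * ((1 - q) * (q * X) / 2 * psi q (q * (q * X))) := by ring
    _ ≤ (1 - q) * (q * X) / 2 * psi q (q * s) :=
        mul_le_mul_of_nonneg_left (by linarith) (by linarith)
    _ ≤ (1 - q) * X / 2 * psi q (q * s) := mul_le_mul_of_nonneg_right (by linarith) p3.le
    _ ≤ _ := by linarith

/-- If `u < N(q)`, then `ψ > 0` up to `X = u / (1 - q)`, and the ratio `ψ(q² X) / ψ(q X)` is at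
least `(e v)^K` but at most `4 / v²`. Since `e v > 1`, a large `K` makes this absurd. -/
theorem eventually_normZero_le {u : ℝ} (hu : 1 / Real.exp 1 < u) :
    ∀ᶠ q in 𝓝[<] (1 : ℝ), normZero q ≤ u := by
  -- The room between `v` and `u` absorbs `q^(K+1)`, which tends to `1` once `K` is fixed; the extra
  -- power of `q` arises because the bootstrap is applied at `q X`.
  obtain ⟨v, hv, hvu⟩ := exists_between hu
  have hv0 : 0 < v := (by positivity : 0 < 1 / Real.exp 1).trans hv
  have hev : 1 < Real.exp 1 * v := by
    rwa [div_lt_iff₀ (Real.exp_pos 1), mul_comm] at hv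
  obtain ⟨K, hK⟩ := pow_unbounded_of_one_lt (4 / v ^ 2) hev
  have hc : Tendsto (fun q : ℝ => q ^ (K + 1) * u) (𝓝[<] 1) (𝓝 u) := by
    have : Tendsto (fun q : ℝ => q ^ (K + 1) * u) (𝓝 1) (𝓝 (1 ^ (K + 1) * u)) :=
      ((continuous_pow (K + 1)).mul continuous_const).tendsto 1
    rw [one_pow, one_mul] at this
    exact this.mono_left nhdsWithin_le_nhds
  filter_upwards [hc.eventually (lt_mem_nhds hvu), self_mem_nhdsWithin,
    mem_nhdsWithin_of_mem_nhds (lt_mem_nhds one_pos)] with q hq hq1 hq0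
  have h1 : q < 1 := hq1
  have h0 : 0 < q := hq0
  by_contra! hlt
  have h2 : 0 < 1 - q := by linarith
  set X := u / (1 - q) with hX
  have hX0 : 0 < X := div_pos (hv0.trans hvu) h2
  have hXZ : X < firstZero q := by rw [hX, div_lt_iff₀ h2, mul_comm]; exact hlt
  have huX : (1 - q) * X = u := mul_div_cancel₀ _ h2.ne'
  have hpos := psi_pos_of_lt_firstZero h0.le h1
  have hqX : q * X < X := mul_lt_of_lt_one_left hX0 h1
  have e : (1 - q) * (q * X) = q * u := by rw [← huX]; ring
  have hlow := pow_mul_psi_le h0 h1.le hv0 hpos K (q * X) (by positivity) (hqX.trans hXZ) (by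
    rw [e, ← mul_assoc, ← pow_succ]; exact hq.le)
  have hup := sq_mul_psi_le h0 h1.le hX0.le fun y hy hyX => hpos y hy (hyX.trans_lt hXZ)
  have hp := hpos (q * X) (by positivity) (hqX.trans hXZ)
  have hvq : v ≤ q * u := hq.le.trans (by
    rw [pow_succ, mul_assoc]
    exact mul_le_of_le_one_left (mul_pos h0 (hv0.trans hvu)).le (pow_le_one₀ h0.le h1.le))
  have hsq : v ^ 2 / 4 ≤ ((1 - q) * (q * X) / 2) ^ 2 := by
    rw [e, div_pow]
    have := pow_le_pow_left₀ hv0.le hvq 2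
    linarith
  have hbig : 1 < v ^ 2 / 4 * (Real.exp 1 * v) ^ K := by
    rw [div_lt_iff₀ (by positivity)] at hK
    linarith
  have : v ^ 2 / 4 * ((Real.exp 1 * v) ^ K * psi q (q * X)) ≤ psi q (q * X) :=
    (mul_le_mul hsq hlow (by positivity) (by positivity)).trans hup
  rw [← mul_assoc] at this
  have := (lt_mul_of_one_lt_left hp hbig).trans_le this
  exact lt_irrefl _ this

theorem tendsto_normZero_one :
    Tendsto normZero (𝓝[<] 1) (𝓝 (1 / Real.exp 1)) := by
  refine tendsto_order.2 ⟨fun a ha => ?_, fun b hb => ?_⟩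
  · filter_upwards [self_mem_nhdsWithin, mem_nhdsWithin_of_mem_nhds (lt_mem_nhds one_pos)]
      with q hq1 hq0
    exact ha.trans (inv_exp_lt_normZero (le_of_lt hq0) hq1)
  · obtain ⟨u, hu, hub⟩ := exists_between hb
    filter_upwards [eventually_normZero_le hu] with q hq
    exact hq.trans_lt hub

theorem tendsto_normZero_zero : Tendsto normZero (𝓝[>] 0) (𝓝 1) := by
  have h : Tendsto (fun q : ℝ => 1 - q) (𝓝[>] 0) (𝓝 1) := by
    have : Tendsto (fun q : ℝ => 1 - q) (𝓝 0) (𝓝 (1 - 0)) :=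
      (continuous_const.sub continuous_id).tendsto 0
    rw [sub_zero] at this
    exact this.mono_left nhdsWithin_le_nhds
  refine tendsto_of_tendsto_of_tendsto_of_le_of_le' h tendsto_const_nhds ?_ ?_ <;>
  filter_upwards [self_mem_nhdsWithin, mem_nhdsWithin_of_mem_nhds (gt_mem_nhds one_pos)]
    with q hq0 hq1
  · exact one_sub_le_normZero (le_of_lt hq0) hq1
  · exact normZero_le_one (le_of_lt hq0) hq1

/-! ### From the uniform gas to `ψ`: partition function and pressure series -/

theorem card_filter_fst_lt_snd (n : ℕ) :
    (Finset.univ.filter fun p : Fin n × Fin n => p.1 < p.2).card = n.choose 2 := by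
  have h : (Finset.univ.filter fun p : Fin n × Fin n => p.1 < p.2).card =
      ∑ j : Fin n, (Finset.univ.filter fun i : Fin n => i < j).card := by
    rw [Finset.card_eq_sum_card_fiberwise (f := Prod.snd) (t := Finset.univ) (by simp)]
    refine Finset.sum_congr rfl fun j _ => ?_
    refine Finset.card_nbij' Prod.fst (fun i => (i, j)) ?_ ?_ ?_ ?_
    · intro p hp; simp at hp ⊢; rw [← hp.2]; exact hp.1
    · intro i hi; simpa using hi
    · intro p hp; simp at hp ⊢; exact Prod.ext rfl hp.2.symm
    · intro i hi; rfl
  rw [h]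
  have h' : ∀ j : Fin n, (Finset.univ.filter fun i : Fin n => i < j).card = (j : ℕ) := by
    intro j
    rw [← Fin.card_Iio j]
    congr 1
    ext i
    simp
  simp_rw [h']
  rw [Fin.sum_univ_eq_sum_range (fun i => i), Finset.sum_range_id, Nat.choose_two_right]

variable {d : ℕ}

/-- The Boltzmann factor `q = e^{-t/|Λ|}` of a pair. -/
def boltzmann (Λ : Container d) (t : ℝ) : ℝ := Real.exp (-(t / Λ.vol))

theorem boltzmann_pos (Λ : Container d) (t : ℝ) : 0 < boltzmann Λ t := Real.exp_pos _

theorem boltzmann_lt_one (Λ : Container d) {t : ℝ} (ht : 0 < t) : boltzmann Λ t < 1 := by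
  rw [boltzmann, Real.exp_lt_one_iff]
  have := div_pos ht Λ.vol_pos
  linarith

theorem canonicalPartition_uniform (Λ : Container d) (t : ℝ) (n : ℕ) :
    canonicalPartition Λ (uniformPotential Λ t) n =
      Λ.vol ^ n * boltzmann Λ t ^ n.choose 2 / n.factorial := by
  have hE : ∀ x : Fin n → EuclideanSpace ℝ (Fin d),
      Real.exp (-energy (uniformPotential Λ t) x) = boltzmann Λ t ^ n.choose 2 := by
    intro x
    rw [energy]
    simp only [uniformPotential, Finset.sum_const, card_filter_fst_lt_snd, nsmul_eq_mul]
    rw [boltzmann, ← Real.exp_nat_mul]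
    congr 1; ring
  have hset : {x : Fin n → EuclideanSpace ℝ (Fin d) | ∀ i, x i ∈ Λ.carrier} =
      Set.univ.pi fun _ => Λ.carrier := by
    ext x; simp
  have hvol : volume.real {x : Fin n → EuclideanSpace ℝ (Fin d) | ∀ i, x i ∈ Λ.carrier} =
      Λ.vol ^ n := by
    rw [hset, Measure.real, volume_pi_pi, Finset.prod_const, Finset.card_univ, Fintype.card_fin,
      ENNReal.toReal_pow]
    rfl
  rw [canonicalPartition]
  simp_rw [hE]
  rw [setIntegral_const, hvol, smul_eq_mul]
  ring

theorem grandPartition_uniform (Λ : Container d) (t : ℝ) :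
    grandPartition Λ (uniformPotential Λ t) =
      PowerSeries.rescale (-Λ.vol) (altExp (boltzmann Λ t)) := by
  ext n
  rw [grandPartition, PowerSeries.coeff_mk, canonicalPartition_uniform, PowerSeries.coeff_rescale,
    altExp, PowerSeries.coeff_mk, neg_pow]
  have : (-1 : ℝ) ^ n * (-1) ^ n = 1 := by rw [← mul_pow]; simp
  linear_combination (-(Λ.vol ^ n * boltzmann Λ t ^ n.choose 2 / n.factorial)) * this

/-- Chain rule for formal substitution: `(1 + X) log' = 1`, evaluated at `f - 1`. -/
theorem mul_derivative_logOf {f : PowerSeries ℝ} (hf : PowerSeries.constantCoeff f = 1) :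
    f * PowerSeries.derivative ℝ (PowerSeries.logOf f) = PowerSeries.derivative ℝ f := by
  have hs : PowerSeries.HasSubst (f - 1) := PowerSeries.HasSubst.of_constantCoeff_zero' (by simp [hf])
  have h1 : (1 + PowerSeries.X) * PowerSeries.derivative ℝ (PowerSeries.log ℝ) = 1 := by
    rw [PowerSeries.deriv_log]
    ext n
    cases n with
    | zero =>
      rw [add_mul, one_mul, map_add, PowerSeries.coeff_zero_X_mul, add_zero, PowerSeries.coeff_mk]
      simp
    | succ n =>
      rw [add_mul, one_mul, map_add, PowerSeries.coeff_succ_X_mul]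
      simp [PowerSeries.coeff_one, pow_succ]
  have h2 := congrArg (PowerSeries.subst (f - 1)) h1
  rw [PowerSeries.subst_mul hs, PowerSeries.subst_add hs, PowerSeries.subst_X hs] at h2
  have h3 : PowerSeries.subst (f - 1) (1 : PowerSeries ℝ) = (1 : PowerSeries ℝ) := by
    rw [← PowerSeries.coe_substAlgHom hs, map_one]
  rw [h3, add_sub_cancel] at h2
  rw [PowerSeries.logOf_eq, PowerSeries.derivative_subst hs, ← mul_assoc, h2, one_mul, map_sub,
    PowerSeries.derivative_one, sub_zero]

theorem derivative_pressureSeries (Λ : Container d) (t : ℝ) :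
    PowerSeries.derivative ℝ (pressureSeries Λ (uniformPotential Λ t)) =
      PowerSeries.rescale (-Λ.vol) (ratioSeries (boltzmann Λ t)) := by
  set q := boltzmann Λ t
  have hV := Λ.vol_pos.ne'
  have h := mul_derivative_logOf (constantCoeff_grandPartition Λ (uniformPotential Λ t))
  rw [grandPartition_uniform] at h
  have hne : PowerSeries.rescale (-Λ.vol) (altExp q) ≠ 0 := by
    rw [← map_zero (PowerSeries.rescale (-Λ.vol))]
    exact (PowerSeries.rescale_injective (neg_ne_zero.2 hV)).ne (altExp_ne_zero q)
  rw [derivative_rescale, derivative_altExp, ← altExp_mul_ratioSeries, map_neg, map_neg,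
    map_mul] at h
  have h2 : PowerSeries.derivative ℝ
      (PowerSeries.logOf (PowerSeries.rescale (-Λ.vol) (altExp q))) =
      PowerSeries.C Λ.vol * PowerSeries.rescale (-Λ.vol) (ratioSeries q) := by
    apply mul_left_cancel₀ hne
    rw [h]
    ring
  rw [pressureSeries, grandPartition_uniform, Derivation.leibniz, PowerSeries.derivative_C,
    smul_zero, add_zero, h2, smul_eq_mul, ← mul_assoc, ← map_mul, one_div_mul_cancel hV, map_one,
    one_mul]

/-! ### Radii of convergence of the pressure and density series -/

theorem norm_ofScalars_coeff (f : PowerSeries ℝ) (n : ℕ) :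
    ‖FormalMultilinearSeries.ofScalars ℂ (fun n => ((PowerSeries.coeff n f : ℝ) : ℂ)) n‖ =
      ‖PowerSeries.coeff n f‖ := by
  rw [FormalMultilinearSeries.ofScalars_norm, Complex.norm_real]

theorem convergenceRadius_eq_of_summable_iff {f : PowerSeries ℝ} {Z : ℝ}
    (h : ∀ x : ℝ, 0 ≤ x → ((Summable fun n => ‖PowerSeries.coeff n f‖ * x ^ n) ↔ x < Z)) :
    convergenceRadius f = ENNReal.ofReal Z := by
  refine le_antisymm (ENNReal.le_of_forall_nnreal_lt fun r hr => ?_)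
    (ENNReal.le_of_forall_nnreal_lt fun r hr => ?_)
  · have := FormalMultilinearSeries.summable_norm_mul_pow _ hr
    simp_rw [norm_ofScalars_coeff] at this
    have := (h r r.2).1 this
    rw [← ENNReal.ofReal_coe_nnreal]
    exact ENNReal.ofReal_le_ofReal this.le
  · refine FormalMultilinearSeries.le_radius_of_summable _ ?_
    simp_rw [norm_ofScalars_coeff]
    refine (h r r.2).2 ?_
    rw [← ENNReal.ofReal_coe_nnreal] at hr
    exact (ENNReal.ofReal_lt_ofReal_iff_of_nonneg r.2).1 hr

theorem convergenceRadius_X_mul_derivative (f : PowerSeries ℝ) :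
    convergenceRadius (PowerSeries.X * PowerSeries.derivative ℝ f) = convergenceRadius f := by
  have hc : ∀ n, ‖PowerSeries.coeff n (PowerSeries.X * PowerSeries.derivative ℝ f)‖ =
      n * ‖PowerSeries.coeff n f‖ := by
    intro n
    cases n with
    | zero => simp
    | succ n =>
      rw [PowerSeries.coeff_succ_X_mul, PowerSeries.coeff_derivative, norm_mul, mul_comm]
      congr 1
      push_cast
      exact Real.norm_of_nonneg (by positivity)
  refine le_antisymm (ENNReal.le_of_forall_nnreal_lt fun r hr => ?_)
    (ENNReal.le_of_forall_nnreal_lt fun r hr => ?_)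
  · have := FormalMultilinearSeries.summable_norm_mul_pow _ hr
    simp_rw [norm_ofScalars_coeff, hc] at this
    refine FormalMultilinearSeries.le_radius_of_summable _ ?_
    simp_rw [norm_ofScalars_coeff]
    rw [← summable_nat_add_iff 1] at this ⊢
    refine Summable.of_nonneg_of_le (fun n => by positivity) (fun n => ?_) this
    refine mul_le_mul_of_nonneg_right ?_ (by positivity)
    refine le_mul_of_one_le_left (norm_nonneg _) ?_
    push_cast
    linarith [n.cast_nonneg (α := ℝ)]
  · obtain ⟨a, ha, C, hC, hb⟩ := FormalMultilinearSeries.norm_mul_pow_le_mul_pow_of_lt_radius _ hr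
    refine FormalMultilinearSeries.le_radius_of_summable _ ?_
    simp_rw [norm_ofScalars_coeff] at hb ⊢
    simp_rw [hc]
    have hs : Summable fun n : ℕ => (n : ℝ) * a ^ n := by
      simpa using summable_pow_mul_geometric_of_norm_lt_one 1
        (r := a) (by rw [Real.norm_of_nonneg ha.1.le]; exact ha.2)
    refine Summable.of_nonneg_of_le (fun n => by positivity) (fun n => ?_) (hs.mul_left C)
    have := mul_le_mul_of_nonneg_left (hb n) n.cast_nonneg
    calc _ = (n : ℝ) * (‖PowerSeries.coeff n f‖ * (r : ℝ) ^ n) := by ring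
      _ ≤ _ := this
      _ = _ := by ring

theorem convergenceRadius_densitySeries (Λ : Container d) (t : ℝ) :
    convergenceRadius (densitySeries Λ (uniformPotential Λ t)) = mayerRadius Λ t :=
  convergenceRadius_X_mul_derivative _

/-- The computation goes through the density, whose coefficients are, up to sign and a power of
`|Λ|`, the shifted coefficients of `G`; absolute convergence at `x` becomes convergence of the ratio
series at `|Λ| x`. -/
theorem mayerRadius_eq (Λ : Container d) {t : ℝ} (ht : 0 < t) :
    mayerRadius Λ t = ENNReal.ofReal (firstZero (boltzmann Λ t) / Λ.vol) := by
  have h0 := (boltzmann_pos Λ t).le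
  have h1 := boltzmann_lt_one Λ ht
  have hV := Λ.vol_pos
  rw [← convergenceRadius_densitySeries]
  refine convergenceRadius_eq_of_summable_iff fun x hx => ?_
  rw [lt_div_iff₀ hV, ← summable_ratio_iff h0 h1 (mul_nonneg hx hV.le), densitySeries,
    derivative_pressureSeries, ← summable_nat_add_iff 1]
  have e : ∀ n, ‖PowerSeries.coeff (n + 1)
      (PowerSeries.X * PowerSeries.rescale (-Λ.vol) (ratioSeries (boltzmann Λ t)))‖ * x ^ (n + 1) =
      x * (ratioCoeff (boltzmann Λ t) n * (x * Λ.vol) ^ n) := by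
    intro n
    rw [PowerSeries.coeff_succ_X_mul, PowerSeries.coeff_rescale, norm_mul, norm_pow, norm_neg,
      Real.norm_of_nonneg hV.le]
    change _ * ‖ratioCoeff (boltzmann Λ t) n‖ * _ = _
    rw [Real.norm_of_nonneg (ratioCoeff_nonneg h0 h1.le n)]
    ring
  simp_rw [e]
  rcases hx.eq_or_lt with rfl | hx
  · simp only [zero_mul, summable_zero, true_iff]
    exact summable_of_ne_finset_zero (s := {0}) fun n hn => by
      simp only [Finset.mem_singleton] at hn
      simp [hn]
  · exact summable_mul_left_iff hx.ne'

theorem normalizedRadius_eq (Λ : Container d) {t : ℝ} (ht : 0 < t) :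
    normalizedRadius Λ t = ENNReal.ofReal (normZero (boltzmann Λ t)) := by
  have h1 := boltzmann_lt_one Λ ht
  have hV := Λ.vol_pos
  rw [normalizedRadius, mayerRadius_eq Λ ht, lam_eq Λ ht.le, ← boltzmann,
    ← ENNReal.ofReal_mul (mul_nonneg hV.le (by linarith)), normZero]
  congr 1
  field_simp

/-! ### Dependence of the Boltzmann factor on `t` and on the container -/

theorem boltzmann_strictAnti (Λ : Container d) : StrictAnti (boltzmann Λ) := fun s t h => by
  have := div_lt_div_of_pos_right h Λ.vol_pos
  exact Real.exp_lt_exp.2 (by linarith)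

theorem tendsto_boltzmann_zero (Λ : Container d) :
    Tendsto (boltzmann Λ) (𝓝[>] 0) (𝓝[<] 1) := by
  refine tendsto_nhdsWithin_iff.2 ⟨?_, ?_⟩
  · have hc : Continuous (boltzmann Λ) :=
      Real.continuous_exp.comp (continuous_id.div_const _).neg
    have := hc.tendsto 0
    rw [show boltzmann Λ 0 = 1 by simp [boltzmann]] at this
    exact this.mono_left nhdsWithin_le_nhds
  · filter_upwards [self_mem_nhdsWithin] with t ht
    exact boltzmann_lt_one Λ ht

theorem tendsto_boltzmann_atTop (Λ : Container d) :
    Tendsto (boltzmann Λ) atTop (𝓝[>] 0) := by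
  refine tendsto_nhdsWithin_iff.2 ⟨?_, Eventually.of_forall fun t => boltzmann_pos Λ t⟩
  exact Real.tendsto_exp_neg_atTop_nhds_zero.comp (tendsto_id.atTop_div_const Λ.vol_pos)

theorem tendsto_boltzmann_eps {t : ℝ} (ht : 0 < t) :
    Tendsto (fun Λ : Container d => boltzmann Λ t)
      (comap (fun Λ : Container d => Λ.eps) (𝓝 0)) (𝓝[<] 1) := by
  refine tendsto_nhdsWithin_iff.2 ⟨?_, Eventually.of_forall fun Λ => boltzmann_lt_one Λ ht⟩
  -- Since `1/|Λ| = 2 ε`, the Boltzmann factor depends on the container only through `ε`, as `exp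
  -- (-2 ε t)`.
  have hc : Continuous fun e : ℝ => Real.exp (-(2 * e * t)) := by fun_prop
  have h := (hc.tendsto 0).comp (tendsto_comap (f := fun Λ : Container d => Λ.eps))
  simp only [mul_zero, zero_mul, neg_zero, Real.exp_zero] at h
  refine h.congr fun Λ => ?_
  have := Λ.vol_pos.ne'
  simp only [Function.comp_apply, Container.eps, boltzmann]
  congr 2
  field_simp

end UniformGas

end

theorem mainTheorem3 (d : ℕ) :
    (∀ Λ : UniformGas.Container d,
      StrictMonoOn (fun t : ℝ => UniformGas.normalizedRadius Λ t) (Set.Ioi 0) ∧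
      (∀ t : ℝ, 0 < t →
        ENNReal.ofReal (1 / Real.exp 1) ≤ UniformGas.normalizedRadius Λ t ∧
        UniformGas.normalizedRadius Λ t ≤ 1) ∧
      Tendsto (fun t : ℝ => UniformGas.normalizedRadius Λ t) (𝓝[>] 0)
        (𝓝 (ENNReal.ofReal (1 / Real.exp 1))) ∧
      Tendsto (fun t : ℝ => UniformGas.normalizedRadius Λ t) atTop (𝓝 1) ∧
      (∀ t : ℝ, 0 < t →
        UniformGas.convergenceRadius
            (UniformGas.densitySeries Λ (UniformGas.uniformPotential Λ t)) =
          UniformGas.mayerRadius Λ t)) ∧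
    (∀ t : ℝ, 0 < t →
      Tendsto (fun Λ : UniformGas.Container d => UniformGas.normalizedRadius Λ t)
        (comap (fun Λ : UniformGas.Container d => Λ.eps) (𝓝 0))
        (𝓝 (ENNReal.ofReal (1 / Real.exp 1)))) := by
  open UniformGas in
  refine ⟨fun Λ => ⟨?_, fun t ht => ⟨?_, ?_⟩, ?_, ?_, fun t _ =>
    convergenceRadius_densitySeries Λ t⟩, fun t ht => ?_⟩
  · intro s hs t ht hst
    have hs : 0 < s := hs
    have ht : 0 < t := ht
    simp only [normalizedRadius_eq Λ hs, normalizedRadius_eq Λ ht]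
    have h := normZero_strictAnti (boltzmann_pos Λ t).le (boltzmann_strictAnti Λ hst)
      (boltzmann_lt_one Λ hs)
    have h' := inv_exp_lt_normZero (boltzmann_pos Λ t).le (boltzmann_lt_one Λ ht)
    exact (ENNReal.ofReal_lt_ofReal_iff ((by positivity : 0 < 1 / Real.exp 1).trans h')).2 h
  · rw [normalizedRadius_eq Λ ht]
    exact ENNReal.ofReal_le_ofReal
      (inv_exp_lt_normZero (boltzmann_pos Λ t).le (boltzmann_lt_one Λ ht)).le
  · rw [normalizedRadius_eq Λ ht, ← ENNReal.ofReal_one]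
    exact ENNReal.ofReal_le_ofReal
      (normZero_le_one (boltzmann_pos Λ t).le (boltzmann_lt_one Λ ht))
  · refine (ENNReal.tendsto_ofReal
      (tendsto_normZero_one.comp (tendsto_boltzmann_zero Λ))).congr' ?_
    filter_upwards [self_mem_nhdsWithin] with t ht
    exact (normalizedRadius_eq Λ ht).symm
  · rw [← ENNReal.ofReal_one]
    refine (ENNReal.tendsto_ofReal
      (tendsto_normZero_zero.comp (tendsto_boltzmann_atTop Λ))).congr' ?_
    filter_upwards [eventually_gt_atTop 0] with t ht
    exact (normalizedRadius_eq Λ ht).symm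
  · exact (ENNReal.tendsto_ofReal
      (tendsto_normZero_one.comp (tendsto_boltzmann_eps ht))).congr fun Λ =>
        (normalizedRadius_eq Λ ht).symm
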